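/- All Banach spaces are complex; $B_X$ denotes the open unit ball of $X$. Let $N\ge 2$, and let $w=(w_n)_{n\ge1}$ be a sequence of positive reals that is decreasing (in the sense $w_{n+1}\le w_n$), with $w_1=1$, $\lim_n w_n=0$, $\sum_n w_n=\infty$ and $w\in\ell_N$. Let $d(w,1)$ be the Lorentz sequence space of all bounded complex sequences $x=(x_n)$ such that $\|x\|_{w,1}=\sum_n x_n^*w_n<\infty$, where $(x_n^*)$ is the decreasing rearrangement of $(|x_n|)$, and let $X=d_*(w,1)$ be its predual, that is, the closed linear span of the coordinate functionals in the dual of $d(w,1)$. Let $Y\neq\{0\}$ be a strictly convex Banach space. Let $\mathcal A_u(B_X;Y)$ be the space of all holomorphic functions $B_X\to Y$ that are uniformly continuous on $B_X$, with the norm $\|f\|_\infty=\sup_{x\in B_X}\|f(x)\|$. For $f\in\mathcal A_u(B_X;Y)$ put $\|f\|_v=\sup_{x\in B_X}(1-\|x\|^2)\|f(x)\|$, and let $\mathrm{NA}_v\mathcal A_u(B_X;Y)$ be the set of those $f\in\mathcal A_u(B_X;Y)$ for which there is $x_0\in\overline{B_X}$ with $\|f\|_v=(1-\|x_0\|^2)\|f(x_0)\|$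 (for $\|x_0\|=1$ the right-hand side is $0$). Let $\mathcal P({}^NX;Y)$ be the space of $N$-homogeneous polynomials, that is, of the maps $x\mapsto A(x,\dots,x)$ with $A:X^N\to Y$ a continuous symmetric $N$-linear map. Then there is $Q\in\mathcal P({}^NX;Y)$ whose restriction to $B_X$ does not belong to the $\|\cdot\|_\infty$-closure of $\mathrm{NA}_v\mathcal A_u(B_X;Y)$ in $\mathcal A_u(B_X;Y)$. In particular, $\mathrm{NA}_v\mathcal A_u(B_X;Y)$ is not $\|\cdot\|_\infty$-dense in $\mathcal A_u(B_X;Y)$. -/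

import Mathlib

open scoped BoundedContinuousFunction

noncomputable section

/-- An admissible sequence `w₁ = 1 ≥ w₂ ≥ …` of positive reals that tends to `0` and whose series
diverges. It is indexed from `0`, so `w n` stands for `w_{n+1}`. -/
structure AdmissibleSeq where
  toFun : ℕ → ℝ
  pos : ∀ n, 0 < toFun n
  antitone : Antitone toFun
  zero_eq_one : toFun 0 = 1
  tendsto_zero : Filter.Tendsto toFun Filter.atTop (nhds 0)
  not_summable : ¬ Summable toFun

instance : CoeFun AdmissibleSeq (fun _ => ℕ → ℝ) := ⟨AdmissibleSeq.toFun⟩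

/-- The decreasing rearrangement of `(|x_i|)`, indexed from `0`: the infimum of the `t ≥ 0` such
that at most `n` of the numbers `|x_i|` exceed `t`. -/
def decRearr (x : ℕ → ℂ) (n : ℕ) : ℝ :=
  sInf {t : ℝ | 0 ≤ t ∧ {i : ℕ | t < ‖x i‖}.encard ≤ n}

/-- `x` is a bounded sequence of complex numbers. -/
def IsBddSeq (x : ℕ → ℂ) : Prop := ∃ C : ℝ, ∀ i, ‖x i‖ ≤ C

/-! ### Facts on the decreasing rearrangement needed for the norm of `d(w,1)` -/

theorem decRearr_nonneg (x : ℕ → ℂ) (n : ℕ) : 0 ≤ decRearr x n :=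
  Real.sInf_nonneg fun _ ht => ht.1

theorem norm_le_decRearr {x : ℕ → ℂ} (hx : IsBddSeq x) (F : Finset ℕ) (n : ℕ) (hn : n < F.card)
    (r : ℝ) (hF : ∀ i ∈ F, r ≤ ‖x i‖) : r ≤ decRearr x n := by
  obtain ⟨C, hC⟩ := hx
  refine le_csInf ⟨max C 0, le_max_right _ _, ?_⟩ ?_
  · have : {i : ℕ | max C 0 < ‖x i‖} = ∅ := by
      ext i
      simp [hC i]
    rw [this, Set.encard_empty]
    exact zero_le
  · rintro t ⟨-, ht⟩
    by_contra! hlt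
    have hsub : (F : Set ℕ) ⊆ {i : ℕ | t < ‖x i‖} := fun i hi => hlt.trans_le (hF i hi)
    have := (Set.encard_le_encard hsub).trans ht
    rw [Set.encard_coe_eq_coe_finsetCard] at this
    have : F.card ≤ n := by exact_mod_cast this
    omega

theorem sum_norm_le_sum_decRearr {x : ℕ → ℂ} (hx : IsBddSeq x) (n : ℕ) :
    ∀ F : Finset ℕ, F.card = n → ∑ i ∈ F, ‖x i‖ ≤ ∑ k ∈ Finset.range n, decRearr x k := by
  induction n with
  | zero =>
    intro F hF
    rw [Finset.card_eq_zero] at hF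
    simp [hF]
  | succ n ih =>
    intro F hF
    have hne : F.Nonempty := Finset.card_pos.1 (by omega)
    obtain ⟨i, hi, hmin⟩ := F.exists_min_image (fun i => ‖x i‖) hne
    rw [← Finset.sum_erase_add _ _ hi, Finset.sum_range_succ]
    exact add_le_add (ih _ (by rw [Finset.card_erase_of_mem hi]; omega))
      (norm_le_decRearr hx F n (by omega) _ hmin)

theorem sum_mul_le_of_antitone {u a b : ℕ → ℝ} (hu : Antitone u) (hu0 : ∀ n, 0 ≤ u n) (n : ℕ)
    (h : ∀ m ≤ n, ∑ k ∈ Finset.range m, a k ≤ ∑ k ∈ Finset.range m, b k) :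
    ∑ k ∈ Finset.range n, u k * a k ≤ ∑ k ∈ Finset.range n, u k * b k := by
  have key : ∀ m ≤ n, u m * ∑ k ∈ Finset.range m, (b k - a k) ≤
      ∑ k ∈ Finset.range m, u k * (b k - a k) := by
    intro m
    induction m with
    | zero => simp
    | succ m ih =>
      intro hm
      have h1 := ih (by omega)
      have h2 := h (m + 1) hm
      rw [← sub_nonneg, ← Finset.sum_sub_distrib] at h2
      have h3 : u (m + 1) * ∑ k ∈ Finset.range (m + 1), (b k - a k) ≤
          u m * ∑ k ∈ Finset.range (m + 1), (b k - a k) :=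
        mul_le_mul_of_nonneg_right (hu (Nat.le_succ m)) h2
      rw [Finset.sum_range_succ _ m, mul_add] at h3
      rw [Finset.sum_range_succ _ m, Finset.sum_range_succ _ m, mul_add]
      rw [mul_add] at h3
      linarith
  have h1 := key n le_rfl
  have h2 := h n le_rfl
  rw [← sub_nonneg, ← Finset.sum_sub_distrib] at h2
  have h3 := mul_nonneg (hu0 n) h2
  have h4 : ∑ k ∈ Finset.range n, u k * (b k - a k) =
      ∑ k ∈ Finset.range n, u k * b k - ∑ k ∈ Finset.range n, u k * a k := by
    rw [← Finset.sum_sub_distrib]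
    exact Finset.sum_congr rfl fun _ _ => mul_sub _ _ _
  linarith

theorem sum_weight_norm_le {x : ℕ → ℂ} (hx : IsBddSeq x) (w : AdmissibleSeq) (n : ℕ)
    (σ : ℕ → ℕ) (hσ : Set.InjOn σ (Set.Iio n)) :
    ∑ k ∈ Finset.range n, w k * ‖x (σ k)‖ ≤ ∑ k ∈ Finset.range n, w k * decRearr x k := by
  refine sum_mul_le_of_antitone w.antitone (fun n => (w.pos n).le) n fun m hm => ?_
  have hinj : Set.InjOn σ (Finset.range m : Set ℕ) := by
    intro a ha b hb h
    simp only [Finset.coe_range, Set.mem_Iio] at ha hb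
    exact hσ (lt_of_lt_of_le ha hm) (lt_of_lt_of_le hb hm) h
  have := sum_norm_le_sum_decRearr hx m ((Finset.range m).image σ)
    (by rw [Finset.card_image_of_injOn hinj, Finset.card_range])
  rwa [Finset.sum_image hinj] at this

theorem exists_decRearr_sub_lt (x : ℕ → ℂ) {ε : ℝ} (hε : 0 < ε) (n : ℕ) :
    ∃ σ : ℕ → ℕ, Set.InjOn σ (Set.Iio n) ∧ ∀ k < n, decRearr x k - ε < ‖x (σ k)‖ := by
  induction n with
  | zero => exact ⟨id, Set.injOn_id _, by simp⟩
  | succ n ih =>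
    obtain ⟨σ, hσ, h⟩ := ih
    have hcard : (n : ℕ∞) < {i : ℕ | decRearr x n - ε < ‖x i‖}.encard := by
      by_contra! hle
      by_cases h0 : 0 ≤ decRearr x n - ε
      · have : decRearr x n ≤ decRearr x n - ε := csInf_le ⟨0, fun _ ht => ht.1⟩ ⟨h0, hle⟩
        linarith
      · have : {i : ℕ | decRearr x n - ε < ‖x i‖} = Set.univ := by
          ext i
          simp only [Set.mem_ofPred_eq, Set.mem_univ, iff_true]
          exact (not_le.1 h0).trans_le (norm_nonneg _)
        rw [this, Set.encard_univ] at hle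
        simp at hle
    obtain ⟨i, hi, hiσ⟩ : ∃ i, decRearr x n - ε < ‖x i‖ ∧ i ∉ σ '' (Set.Iio n) := by
      by_contra! hcon
      have h1 := Set.encard_le_encard (show {i : ℕ | decRearr x n - ε < ‖x i‖} ⊆ _ from hcon)
      have h2 := (h1.trans (Set.encard_image_le σ (Set.Iio n)))
      rw [← Finset.coe_range, Set.encard_coe_eq_coe_finsetCard, Finset.card_range] at h2
      exact absurd (hcard.trans_le h2) (lt_irrefl _)
    refine ⟨Function.update σ n i, ?_, ?_⟩
    · intro a ha b hb hab
      simp only [Set.mem_Iio] at ha hb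
      by_cases han : a = n <;> by_cases hbn : b = n
      · rw [han, hbn]
      · subst han
        rw [Function.update_self, Function.update_of_ne hbn] at hab
        exact absurd ⟨b, show b < a by omega, hab.symm⟩ hiσ
      · subst hbn
        rw [Function.update_self, Function.update_of_ne han] at hab
        exact absurd ⟨a, show a < b by omega, hab⟩ hiσ
      · rw [Function.update_of_ne hbn, Function.update_of_ne han] at hab
        exact hσ (show a < n by omega) (show b < n by omega) hab
    · intro k hk
      by_cases hkn : k = n
      · subst hkn
        rwa [Function.update_self]
      · rw [Function.update_of_ne hkn]
        exact h k (by omega)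

theorem sum_weight_decRearr_le (w : AdmissibleSeq) {x : ℕ → ℂ} {n : ℕ} {B : ℝ}
    (h : ∀ σ : ℕ → ℕ, Set.InjOn σ (Set.Iio n) →
      ∑ k ∈ Finset.range n, w k * ‖x (σ k)‖ ≤ B) :
    ∑ k ∈ Finset.range n, w k * decRearr x k ≤ B := by
  refine le_of_forall_pos_le_add fun ε hε => ?_
  have hn : (0 : ℝ) < n + 1 := by positivity
  obtain ⟨σ, hσ, hlt⟩ := exists_decRearr_sub_lt x (div_pos hε hn) n
  have h1 : ∑ k ∈ Finset.range n, w k * decRearr x k ≤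
      ∑ k ∈ Finset.range n, (w k * ‖x (σ k)‖ + ε / (n + 1)) := by
    refine Finset.sum_le_sum fun k hk => ?_
    have h2 := hlt k (Finset.mem_range.1 hk)
    have h3 : w k ≤ 1 := by
      rw [← w.zero_eq_one]
      exact w.antitone (Nat.zero_le k)
    have h4 : 0 < ε / ((n : ℝ) + 1) := div_pos hε hn
    nlinarith [w.pos k, mul_le_mul_of_nonneg_right h3 h4.le,
      mul_le_mul_of_nonneg_left h2.le (w.pos k).le]
  rw [Finset.sum_add_distrib, Finset.sum_const, Finset.card_range, nsmul_eq_mul] at h1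
  have h5 : (n : ℝ) * (ε / (n + 1)) ≤ ε := by
    rw [← mul_div_assoc, div_le_iff₀ hn]
    nlinarith
  linarith [h σ hσ]

/-! ### The Lorentz sequence space `d(w,1)` -/

/-- Membership in `d(w,1)`: bounded sequences with `∑ x*_n w_n < ∞`. -/
def MemLorentz (w : AdmissibleSeq) (x : ℕ → ℂ) : Prop :=
  IsBddSeq x ∧ Summable fun n => decRearr x n * w n

theorem memLorentz_of_bound {w : AdmissibleSeq} {x : ℕ → ℂ} {B : ℝ} (hx : IsBddSeq x)
    (h : ∀ (n : ℕ) (σ : ℕ → ℕ), Set.InjOn σ (Set.Iio n) →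
      ∑ k ∈ Finset.range n, w k * ‖x (σ k)‖ ≤ B) :
    MemLorentz w x ∧ ∑' n, decRearr x n * w n ≤ B := by
  have h0 : ∀ n, 0 ≤ decRearr x n * w n := fun n => mul_nonneg (decRearr_nonneg x n) (w.pos n).le
  have h1 : ∀ n, ∑ k ∈ Finset.range n, decRearr x k * w k ≤ B := by
    intro n
    simpa only [mul_comm] using sum_weight_decRearr_le w (h n)
  exact ⟨⟨hx, summable_of_sum_range_le h0 h1⟩, Real.tsum_le_of_sum_range_le h0 h1⟩

theorem MemLorentz.sum_le {w : AdmissibleSeq} {x : ℕ → ℂ} (hx : MemLorentz w x) (n : ℕ)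
    (σ : ℕ → ℕ) (hσ : Set.InjOn σ (Set.Iio n)) :
    ∑ k ∈ Finset.range n, w k * ‖x (σ k)‖ ≤ ∑' n, decRearr x n * w n := by
  refine (sum_weight_norm_le hx.1 w n σ hσ).trans ?_
  simp only [mul_comm (w _)]
  exact hx.2.sum_le_tsum _ fun k _ => mul_nonneg (decRearr_nonneg x k) (w.pos k).le

theorem MemLorentz.add {w : AdmissibleSeq} {x y : ℕ → ℂ} (hx : MemLorentz w x)
    (hy : MemLorentz w y) : MemLorentz w (x + y) ∧
      ∑' n, decRearr (x + y) n * w n ≤ ∑' n, decRearr x n * w n + ∑' n, decRearr y n * w n := by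
  refine memLorentz_of_bound ?_ fun n σ hσ => ?_
  · obtain ⟨C, hC⟩ := hx.1
    obtain ⟨D, hD⟩ := hy.1
    exact ⟨C + D, fun i => (norm_add_le _ _).trans (add_le_add (hC i) (hD i))⟩
  · refine le_trans ?_ (add_le_add (hx.sum_le n σ hσ) (hy.sum_le n σ hσ))
    rw [← Finset.sum_add_distrib]
    refine Finset.sum_le_sum fun k _ => ?_
    rw [← mul_add]
    exact mul_le_mul_of_nonneg_left (norm_add_le _ _) (w.pos k).le

theorem MemLorentz.smul {w : AdmissibleSeq} {x : ℕ → ℂ} (c : ℂ) (hx : MemLorentz w x) :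
    MemLorentz w (c • x) ∧
      ∑' n, decRearr (c • x) n * w n ≤ ‖c‖ * ∑' n, decRearr x n * w n := by
  refine memLorentz_of_bound ?_ fun n σ hσ => ?_
  · obtain ⟨C, hC⟩ := hx.1
    refine ⟨‖c‖ * C, fun i => ?_⟩
    rw [Pi.smul_apply, norm_smul]
    exact mul_le_mul_of_nonneg_left (hC i) (norm_nonneg c)
  · refine le_trans (le_of_eq ?_) (mul_le_mul_of_nonneg_left (hx.sum_le n σ hσ) (norm_nonneg c))
    rw [Finset.mul_sum]
    refine Finset.sum_congr rfl fun k _ => ?_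
    rw [Pi.smul_apply, norm_smul]
    ring

theorem memLorentz_zero (w : AdmissibleSeq) : MemLorentz w 0 :=
  (memLorentz_of_bound (B := 0) ⟨0, by simp⟩ (by simp)).1

/-- `d(w,1)` as a vector space of sequences. -/
def lorentzSubmodule (w : AdmissibleSeq) : Submodule ℂ (ℕ → ℂ) where
  carrier := {x | MemLorentz w x}
  add_mem' hx hy := (MemLorentz.add hx hy).1
  zero_mem' := memLorentz_zero w
  smul_mem' c _ hx := (MemLorentz.smul c hx).1

/-- The Lorentz sequence space `d(w,1)`. -/
def Lorentz (w : AdmissibleSeq) : Type := lorentzSubmodule w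

namespace Lorentz

variable {w : AdmissibleSeq}

section Construction

/-- The vector space structure, used to construct the normed space structure below. -/
abbrev addCommGroup : AddCommGroup (Lorentz w) :=
  inferInstanceAs (AddCommGroup (lorentzSubmodule w))

attribute [local instance] addCommGroup

/-- The scalar multiplication, used to construct the normed space structure below. -/
abbrev module : Module ℂ (Lorentz w) := inferInstanceAs (Module ℂ (lorentzSubmodule w))

attribute [local instance] module

/-- The underlying sequence. -/
def seq (x : Lorentz w) : ℕ → ℂ := x.1

theorem memLorentz (x : Lorentz w) : MemLorentz w x.seq := x.2

/-- The norm `‖x‖_{w,1} = ∑ x*_n w_n`. -/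
instance : Norm (Lorentz w) := ⟨fun x => ∑' n, decRearr x.seq n * w n⟩

theorem norm_def (x : Lorentz w) : ‖x‖ = ∑' n, decRearr x.seq n * w n := rfl

theorem norm_seq_le (x : Lorentz w) (i : ℕ) : ‖x.seq i‖ ≤ ‖x‖ := by
  have := x.memLorentz.sum_le 1 (fun _ => i) (by intro a ha b hb _; simp_all)
  rw [norm_def]
  simpa [w.zero_eq_one] using this

theorem normCore : NormedSpace.Core ℂ (Lorentz w) where
  norm_nonneg x := tsum_nonneg fun n => mul_nonneg (decRearr_nonneg _ n) (w.pos n).le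
  norm_smul c x := by
    have hle : ∀ (c : ℂ) (x : Lorentz w), ‖c • x‖ ≤ ‖c‖ * ‖x‖ := fun c x =>
      (MemLorentz.smul c x.memLorentz).2
    refine le_antisymm (hle c x) ?_
    by_cases hc : c = 0
    · subst hc
      rw [norm_zero, zero_mul]
      exact tsum_nonneg fun n => mul_nonneg (decRearr_nonneg _ n) (w.pos n).le
    · have h := hle c⁻¹ (c • x)
      rw [inv_smul_smul₀ hc, norm_inv, inv_mul_eq_div, le_div_iff₀ (norm_pos_iff.2 hc)] at h
      linarith
  norm_triangle x y := (MemLorentz.add x.memLorentz y.memLorentz).2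
  norm_eq_zero_iff x := by
    constructor
    · intro h
      refine Subtype.ext (funext fun i => ?_)
      have := norm_seq_le x i
      rw [h] at this
      exact norm_le_zero_iff.1 this
    · rintro rfl
      exact le_antisymm (memLorentz_of_bound (w := w) (x := 0) (B := 0) ⟨0, by simp⟩ (by simp)).2
        (tsum_nonneg fun n => mul_nonneg (decRearr_nonneg _ n) (w.pos n).le)

instance : NormedAddCommGroup (Lorentz w) := NormedAddCommGroup.ofCore normCore

instance : NormedSpace ℂ (Lorentz w) := NormedSpace.ofCore normCore

end Construction

/-- The coordinate functional `x ↦ x_n` on `d(w,1)`. -/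
def coord (w : AdmissibleSeq) (n : ℕ) : StrongDual ℂ (Lorentz w) :=
  LinearMap.mkContinuous
    { toFun := fun x => x.seq n
      map_add' := fun _ _ => rfl
      map_smul' := fun _ _ => rfl } 1 (fun x => by rw [one_mul]; exact norm_seq_le x n)

@[simp] theorem coord_apply (n : ℕ) (x : Lorentz w) : coord w n x = x.seq n := rfl

end Lorentz

/-- The closed linear span of the coordinate functionals in the dual of `d(w,1)`. -/
def lorentzPredualSubmodule (w : AdmissibleSeq) : Submodule ℂ (StrongDual ℂ (Lorentz w)) :=
  (Submodule.span ℂ (Set.range (Lorentz.coord w))).topologicalClosure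

/-- The predual `d_*(w,1)` of `d(w,1)`: the closed linear span of the coordinate functionals in the
dual of `d(w,1)`, with the dual norm. The theorem `lorentzPredual_dual` below shows that its dual is
`d(w,1)`, isometrically and through the natural pairing. -/
def LorentzPredual (w : AdmissibleSeq) : Type := lorentzPredualSubmodule w

namespace LorentzPredual

variable {w : AdmissibleSeq}

instance : NormedAddCommGroup (LorentzPredual w) :=
  inferInstanceAs (NormedAddCommGroup (lorentzPredualSubmodule w))

instance : NormedSpace ℂ (LorentzPredual w) :=
  inferInstanceAs (NormedSpace ℂ (lorentzPredualSubmodule w))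

instance : CompleteSpace (LorentzPredual w) :=
  inferInstanceAs
    (CompleteSpace (Submodule.span ℂ (Set.range (Lorentz.coord w))).topologicalClosure)

/-- The inclusion of `d_*(w,1)` in the dual of `d(w,1)`. -/
def incl (w : AdmissibleSeq) : LorentzPredual w →ₗᵢ[ℂ] StrongDual ℂ (Lorentz w) :=
  (lorentzPredualSubmodule w).subtypeₗᵢ

/-- The `n`-th coordinate functional as an element of `d_*(w,1)`. -/
def basisVec (w : AdmissibleSeq) (n : ℕ) : LorentzPredual w :=
  ⟨Lorentz.coord w n, Submodule.le_topologicalClosure _ (Submodule.subset_span ⟨n, rfl⟩)⟩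

@[simp] theorem incl_basisVec (n : ℕ) : incl w (basisVec w n) = Lorentz.coord w n := rfl

theorem dense_span_basisVec :
    Dense (Submodule.span ℂ (Set.range (basisVec w)) : Set (LorentzPredual w)) := by
  intro u
  have hu : incl w u ∈ closure
      (Submodule.span ℂ (Set.range (Lorentz.coord w)) : Set (StrongDual ℂ (Lorentz w))) := u.2
  have himg : (Submodule.span ℂ (Set.range (Lorentz.coord w)) : Set (StrongDual ℂ (Lorentz w))) =
      incl w '' (Submodule.span ℂ (Set.range (basisVec w)) : Set (LorentzPredual w)) := by
    have h1 : Set.range (Lorentz.coord w) =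
        (incl w).toLinearMap '' Set.range (basisVec w) := by
      rw [← Set.range_comp]
      rfl
    rw [h1, ← Submodule.map_span]
    rfl
  rw [himg] at hu
  exact (incl w).isometry.isUniformInducing.isInducing.closure_eq_preimage_closure_image _ ▸ hu

end LorentzPredual

theorem lorentzPredual_dual (w : AdmissibleSeq) :
    ∃ Φ : Lorentz w ≃ₗᵢ[ℂ] StrongDual ℂ (LorentzPredual w),
      ∀ (a : Lorentz w) (φ : LorentzPredual w), Φ a φ = LorentzPredual.incl w φ a := by
  have key : ∀ (b : ℕ → ℂ) (n : ℕ) (σ : ℕ → ℕ), Set.InjOn σ (Set.Iio n) →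
      ∃ u : LorentzPredual w, ‖u‖ ≤ 1 ∧ ∀ ψ : StrongDual ℂ (LorentzPredual w),
        (∀ k, ψ (LorentzPredual.basisVec w k) = b k) →
          ψ u = (∑ k ∈ Finset.range n, w k * ‖b (σ k)‖ : ℝ) := by
    intro b n σ hσ
    have hc : ∀ z : ℂ, ∃ c : ℂ, ‖c‖ ≤ 1 ∧ c * z = ‖z‖ := by
      intro z
      by_cases hz : z = 0
      · exact ⟨0, by simp, by simp [hz]⟩
      · refine ⟨‖z‖ / z, ?_, div_mul_cancel₀ _ hz⟩
        rw [norm_div, Complex.norm_real, norm_norm, div_self (norm_ne_zero_iff.2 hz)]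
    choose c hc1 hc2 using hc
    refine ⟨∑ k ∈ Finset.range n,
      ((w k : ℂ) * c (b (σ k))) • LorentzPredual.basisVec w (σ k), ?_, ?_⟩
    · rw [← (LorentzPredual.incl w).norm_map, map_sum]
      refine ContinuousLinearMap.opNorm_le_bound _ zero_le_one fun a => ?_
      rw [one_mul]
      refine le_trans ?_ (a.memLorentz.sum_le n σ hσ)
      rw [sum_apply]
      refine (norm_sum_le _ _).trans (Finset.sum_le_sum fun k _ => ?_)
      rw [map_smul, LorentzPredual.incl_basisVec, smul_apply, Lorentz.coord_apply,
        norm_smul, norm_mul, Complex.norm_real, Real.norm_of_nonneg (w.pos k).le, mul_assoc]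
      refine mul_le_mul_of_nonneg_left ?_ (w.pos k).le
      exact mul_le_of_le_one_left (norm_nonneg _) (hc1 _)
    · intro ψ hψ
      rw [map_sum]
      push_cast
      refine Finset.sum_congr rfl fun k _ => ?_
      rw [map_smul, hψ, smul_eq_mul, mul_assoc, hc2]
  let L : Lorentz w →ₗ[ℂ] StrongDual ℂ (LorentzPredual w) :=
    { toFun := fun a =>
        LinearMap.mkContinuous
          { toFun := fun φ : LorentzPredual w => LorentzPredual.incl w φ a
            map_add' := fun _ _ => rfl
            map_smul' := fun _ _ => rfl } ‖a‖
          (fun φ => by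
            rw [mul_comm, ← (LorentzPredual.incl w).norm_map]
            exact (LorentzPredual.incl w φ).le_opNorm a)
      map_add' := fun a b => by
        ext φ
        exact map_add (LorentzPredual.incl w φ) a b
      map_smul' := fun c a => by
        ext φ
        exact map_smul (LorentzPredual.incl w φ) c a }
  have bound : ∀ (ψ : StrongDual ℂ (LorentzPredual w)) (b : ℕ → ℂ),
      (∀ k, ψ (LorentzPredual.basisVec w k) = b k) →
      MemLorentz w b ∧ ∑' n, decRearr b n * w n ≤ ‖ψ‖ := by
    intro ψ b hb
    have hb1 : ∀ (n : ℕ) (σ : ℕ → ℕ), Set.InjOn σ (Set.Iio n) →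
        ∑ k ∈ Finset.range n, w k * ‖b (σ k)‖ ≤ ‖ψ‖ := by
      intro n σ hσ
      obtain ⟨u, hu, h⟩ := key b n σ hσ
      have h1 := ψ.le_opNorm u
      rw [h ψ hb, Complex.norm_real] at h1
      exact (le_abs_self _).trans (h1.trans (mul_le_of_le_one_right (norm_nonneg _) hu))
    refine memLorentz_of_bound ⟨‖ψ‖, fun i => ?_⟩ hb1
    have := hb1 1 (fun _ => i) (by intro a ha b hb _; simp_all)
    simpa [w.zero_eq_one] using this
  have hiso : ∀ a, ‖L a‖ = ‖a‖ := by
    intro a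
    refine le_antisymm (ContinuousLinearMap.opNorm_le_bound _ (norm_nonneg a) fun φ => ?_) ?_
    · rw [mul_comm, ← (LorentzPredual.incl w).norm_map]
      exact (LorentzPredual.incl w φ).le_opNorm a
    exact (bound (L a) a.seq fun k => rfl).2
  have hsurj : Function.Surjective L := by
    intro ψ
    let a : Lorentz w := ⟨fun k => ψ (LorentzPredual.basisVec w k), (bound ψ _ fun k => rfl).1⟩
    refine ⟨a, ContinuousLinearMap.ext_on LorentzPredual.dense_span_basisVec ?_⟩
    rintro _ ⟨k, rfl⟩
    rfl
  exact ⟨LinearIsometryEquiv.ofSurjective ⟨L, hiso⟩ hsurj, fun a φ => rfl⟩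

/-! ### Holomorphic functions, polynomials and the `v`-norm -/

section Holomorphic

variable (X Y : Type*) [NormedAddCommGroup X] [NormedSpace ℂ X]
  [NormedAddCommGroup Y] [NormedSpace ℂ Y]

/-- The open unit ball `B_X`. -/
abbrev UnitBall : Type _ := Metric.ball (0 : X) 1

/-- `𝒜_u(B_X;Y)`: the functions on the open unit ball that are holomorphic (Fréchet differentiable
over `ℂ`) and uniformly continuous. Such functions are bounded; the norm inherited from the bounded
continuous functions on the open unit ball is the supremum norm. -/
def Au : Submodule ℂ (UnitBall X →ᵇ Y) where
  carrier := {f | UniformContinuous f ∧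
    ∃ F : X → Y, DifferentiableOn ℂ F (Metric.ball 0 1) ∧ ∀ x : UnitBall X, f x = F x}
  add_mem' := by
    rintro f g ⟨hf, F, hF, hfF⟩ ⟨hg, G, hG, hgG⟩
    exact ⟨hf.add hg, F + G, hF.add hG, fun x => by simp [hfF, hgG]⟩
  zero_mem' := ⟨uniformContinuous_const, 0, differentiableOn_const 0, fun _ => rfl⟩
  smul_mem' := by
    rintro c f ⟨hf, F, hF, hfF⟩
    exact ⟨hf.const_smul c, c • F, hF.const_smul c, fun x => by simp [hfF]⟩

/-- `𝒫(^N X;Y)`: the maps `x ↦ A(x,…,x)` with `A` continuous, `N`-linear and symmetric. -/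
def HomPoly (N : ℕ) : Set (X → Y) :=
  {P | ∃ A : ContinuousMultilinearMap ℂ (fun _ : Fin N => X) Y,
    (∀ (σ : Equiv.Perm (Fin N)) (u : Fin N → X), A (u ∘ σ) = A u) ∧
      ∀ x, P x = A fun _ => x}

variable {X Y}

/-- The weighted norm `‖f‖_v = sup (1 - ‖x‖²) ‖f(x)‖` over the open unit ball. -/
def vNorm (f : Au X Y) : ℝ := ⨆ x : UnitBall X, (1 - ‖(x : X)‖ ^ 2) * ‖f.1 x‖

/-- The supremum that defines `‖f‖_v` is that of a bounded set. -/
theorem bddAbove_vNorm (f : Au X Y) :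
    BddAbove (Set.range fun x : UnitBall X => (1 - ‖(x : X)‖ ^ 2) * ‖f.1 x‖) := by
  refine ⟨‖f.1‖, ?_⟩
  rintro _ ⟨x, rfl⟩
  have h1 := f.1.norm_coe_le_norm x
  have h2 : ‖(x : X)‖ < 1 := mem_ball_zero_iff.1 x.2
  have h3 : 1 - ‖(x : X)‖ ^ 2 ≤ 1 := by nlinarith [sq_nonneg ‖(x : X)‖]
  have h4 : 0 ≤ 1 - ‖(x : X)‖ ^ 2 := by nlinarith [norm_nonneg (x : X)]
  exact (mul_le_of_le_one_left (norm_nonneg _) h3).trans h1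

/-- `f` attains its `v`-norm at a point of the closed unit ball. For `x₀` on the unit sphere the
weight is `0`, so that the value of (an extension of) `f` there does not matter; the extension by
`0` is used. -/
def AttainsVNorm (f : Au X Y) : Prop :=
  ∃ x₀ ∈ Metric.closedBall (0 : X) 1,
    vNorm f = (1 - ‖x₀‖ ^ 2) * ‖Function.extend Subtype.val f.1 0 x₀‖

variable (X Y) in
/-- `NA_v 𝒜_u(B_X;Y)`: the functions that attain their `v`-norm. -/
def NAv : Set (Au X Y) := {f | AttainsVNorm f}

/-- An `N`-homogeneous polynomial, restricted to the unit ball, belongs to `𝒜_u(B_X;Y)`. -/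
theorem HomPoly.exists_mem_Au {N : ℕ} {P : X → Y} (hP : P ∈ HomPoly X Y N) :
    ∃ q : Au X Y, ∀ x : UnitBall X, q.1 x = P x := by
  obtain ⟨A, -, hA⟩ := hP
  have hlip : ∀ x y : UnitBall X, ‖P x - P y‖ ≤ ‖A‖ * N * ‖(x : X) - y‖ := by
    intro x y
    rw [hA, hA]
    refine (A.norm_image_sub_le _ _).trans ?_
    have hx : ‖(x : X)‖ ≤ 1 := (mem_ball_zero_iff.1 x.2).le
    have hy : ‖(y : X)‖ ≤ 1 := (mem_ball_zero_iff.1 y.2).le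
    have h1 : max ‖fun _ : Fin N => (x : X)‖ ‖fun _ : Fin N => (y : X)‖ ≤ 1 :=
      max_le ((pi_norm_const_le _).trans hx) ((pi_norm_const_le _).trans hy)
    have h2 : ‖(fun _ : Fin N => (x : X)) - fun _ => (y : X)‖ ≤ ‖(x : X) - y‖ :=
      pi_norm_const_le ((x : X) - y)
    have h3 : max ‖fun _ : Fin N => (x : X)‖ ‖fun _ : Fin N => (y : X)‖ ^ (N - 1) ≤ 1 :=
      pow_le_one₀ (le_max_of_le_left (norm_nonneg _)) h1
    rw [Fintype.card_fin]
    refine mul_le_mul ?_ h2 (norm_nonneg _) (by positivity)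
    exact mul_le_of_le_one_right (by positivity) h3
  have huc : UniformContinuous fun x : UnitBall X => P x := by
    refine (LipschitzWith.of_dist_le_mul (K := ⟨‖A‖ * N, by positivity⟩) fun x y => ?_).uniformContinuous
    rw [dist_eq_norm, Subtype.dist_eq, dist_eq_norm]
    exact hlip x y
  have hb : ∀ x : UnitBall X, ‖P x‖ ≤ ‖A‖ := by
    intro x
    rw [hA]
    refine (A.le_opNorm _).trans (mul_le_of_le_one_right (norm_nonneg _) ?_)
    exact Finset.prod_le_one (fun _ _ => norm_nonneg _) fun _ _ => (mem_ball_zero_iff.1 x.2).le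
  refine ⟨⟨BoundedContinuousFunction.ofNormedAddCommGroup _ huc.continuous ‖A‖ hb, huc, P, ?_,
    fun _ => rfl⟩, fun _ => rfl⟩
  have hP : P = fun x => A fun _ => x := funext hA
  rw [hP]
  have hd : Differentiable ℂ fun x : X => A fun _ : Fin N => x := fun x =>
    ((A.hasFDerivAt fun _ => x).comp x
      (hasFDerivAt_pi.2 fun _ => hasFDerivAt_id x)).differentiableAt
  exact hd.differentiableOn

/-- The restriction of an `N`-homogeneous polynomial to the unit ball, as an element of
`𝒜_u(B_X;Y)`. -/
def HomPoly.toAu {N : ℕ} (P : HomPoly X Y N) : Au X Y := (HomPoly.exists_mem_Au P.2).choose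

theorem HomPoly.toAu_apply {N : ℕ} (P : HomPoly X Y N) (x : UnitBall X) :
    (HomPoly.toAu P).1 x = P.1 x := (HomPoly.exists_mem_Au P.2).choose_spec x

end Holomorphic

end

/-! The witness is the diagonal polynomial `Q(x) = (∑ₖ x(k)^N) y` with `‖y‖ = 1`. Write `W m` for
the sum of the first `m` weights. The norm of `u` in `d_*(w,1)` is the least `C ≥ 0` such that the
moduli of the coefficients over any finite `F` sum to at most `C * W F.card` (`sum_norm_coeff_le`,
`norm_le_of_sum_norm_coeff_le`). Majorization by `w ∈ ℓ_N` then makes the series defining `Q`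
converge.

The geometry is in `exists_norm_add_smul_basisVec_le`: if `u ≠ 0`, adding small multiples of a far
basis vector does not increase the norm. Let `f`, within `ε` of `Q`, attain a positive `v`-norm at
`x ≠ 0`. The weight decreases with the norm, so `‖f‖` is maximal at `x` over the closed ball of
radius `‖x‖`. The maximum principle in the strictly convex space `Y`, followed by the identity
theorem, makes `f` constant on the discs `x + c e_n`, `|c| < 1 - ‖x‖`, for all large `n`
(`apply_add_smul_eq_of_flat`). Along such a disc `Q` changes by almost `c^N`, so `ρ^N ≤ 2ε` whenever
`0 ≤ ρ < 1 - ‖x‖`: for small `ε` the point `x` is close to the sphere. There the weight nearly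
vanishes, whereas the value of `f` at `e_0 / 2` keeps its `v`-norm away from zero. -/

noncomputable section

/-! ### Sorting and majorization -/

/-- Induction on the cardinality: a minimizer of `g` on `F` is put in the last place. -/
theorem exists_injOn_antitoneOn_comp (g : ℕ → ℝ) (n : ℕ) : ∀ F : Finset ℕ, F.card = n →
    ∃ σ : ℕ → ℕ, Set.InjOn σ (Set.Iio n) ∧ (Finset.range n).image σ = F ∧
      AntitoneOn (fun k => g (σ k)) (Set.Iio n) := by
  induction n with
  | zero =>
    intro F hF
    rw [Finset.card_eq_zero] at hF
    exact ⟨id, Set.injOn_id _, by simp [hF], fun a ha => by simp at ha⟩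
  | succ n ih =>
    intro F hF
    obtain ⟨i, hi, hmin⟩ := F.exists_min_image g (Finset.card_pos.1 (by omega))
    obtain ⟨σ, hσ, himg, hanti⟩ := ih (F.erase i) (by rw [Finset.card_erase_of_mem hi]; omega)
    have hmem : ∀ k < n, σ k ∈ F.erase i := fun k hk => by
      rw [← himg]
      exact Finset.mem_image_of_mem _ (Finset.mem_range.2 hk)
    have hup : ∀ k < n, Function.update σ n i k = σ k := fun k hk =>
      Function.update_of_ne hk.ne _ _
    refine ⟨Function.update σ n i, ?_, ?_, ?_⟩
    · intro a ha b hb hab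
      rcases Nat.lt_succ_iff_lt_or_eq.1 ha with ha | rfl <;>
        rcases Nat.lt_succ_iff_lt_or_eq.1 hb with hb | rfl
      · rw [hup a ha, hup b hb] at hab
        exact hσ ha hb hab
      · rw [hup a ha, Function.update_self] at hab
        exact absurd hab (Finset.ne_of_mem_erase (hmem a ha))
      · rw [hup b hb, Function.update_self] at hab
        exact absurd hab.symm (Finset.ne_of_mem_erase (hmem b hb))
      · rfl
    · rw [Finset.range_add_one, Finset.image_insert, Function.update_self,
        Finset.image_congr (g := σ) (fun k hk => hup k (by simpa using hk)), himg,
        Finset.insert_erase hi]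
    · intro a ha b hb hab
      rcases Nat.lt_succ_iff_lt_or_eq.1 ha with ha | rfl <;>
        rcases Nat.lt_succ_iff_lt_or_eq.1 hb with hb | rfl
      · simp only [hup a ha, hup b hb]
        exact hanti ha hb hab
      · simp only [hup a ha, Function.update_self]
        exact hmin _ (Finset.mem_of_mem_erase (hmem a ha))
      · omega
      · exact le_rfl

/-- Extending `u` by zero from `n` on keeps it antitone, because `u` is nonnegative before `n`. -/
theorem sum_mul_le_of_antitoneOn {u a b : ℕ → ℝ} {n : ℕ} (hu : AntitoneOn u (Set.Iio n))
    (hu0 : ∀ k < n, 0 ≤ u k)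
    (h : ∀ m ≤ n, ∑ k ∈ Finset.range m, a k ≤ ∑ k ∈ Finset.range m, b k) :
    ∑ k ∈ Finset.range n, u k * a k ≤ ∑ k ∈ Finset.range n, u k * b k := by
  have h1 := sum_mul_le_of_antitone (u := fun k => if k < n then u k else 0) (a := a) (b := b)
    (by
      intro i j hij
      by_cases hj : j < n
      · simp only [hj, hij.trans_lt hj, if_true]
        exact hu (hij.trans_lt hj) hj hij
      · simp only [hj, if_false]
        split_ifs with hi
        exacts [hu0 i hi, le_rfl])
    (by
      intro i
      split_ifs with hi
      exacts [hu0 i hi, le_rfl]) n h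
  have h2 : ∀ c : ℕ → ℝ, ∑ k ∈ Finset.range n, (if k < n then u k else 0) * c k =
      ∑ k ∈ Finset.range n, u k * c k := fun c =>
    Finset.sum_congr rfl fun k hk => by rw [if_pos (Finset.mem_range.1 hk)]
  simpa only [h2] using h1

/-- If the sums of `m` of the numbers `a i` are dominated by the `m`-th partial sums of `v`, then
the decreasing enumeration over a finite set is weakly majorized by `v`. -/
theorem sum_range_comp_le {a v : ℕ → ℝ}
    (h : ∀ F : Finset ℕ, ∑ i ∈ F, a i ≤ ∑ k ∈ Finset.range F.card, v k) {n : ℕ} {σ : ℕ → ℕ}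
    (hσ : Set.InjOn σ (Set.Iio n)) {m : ℕ} (hm : m ≤ n) :
    ∑ k ∈ Finset.range m, a (σ k) ≤ ∑ k ∈ Finset.range m, v k := by
  have hinj : Set.InjOn σ (Finset.range m : Set ℕ) := by
    refine hσ.mono fun k hk => ?_
    simp only [Finset.coe_range, Set.mem_Iio] at hk ⊢
    omega
  have := h ((Finset.range m).image σ)
  rwa [Finset.sum_image hinj, Finset.card_image_of_injOn hinj, Finset.card_range] at this

/-- Weak majorization passes to `N`-th powers. After sorting, the factors `a` are exchanged for `v`
one at a time, each time by Abel summation. -/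
theorem sum_pow_le_of_sum_le {a v : ℕ → ℝ} (ha : ∀ i, 0 ≤ a i) (hv : Antitone v)
    (hv0 : ∀ k, 0 ≤ v k)
    (h : ∀ F : Finset ℕ, ∑ i ∈ F, a i ≤ ∑ k ∈ Finset.range F.card, v k) (N : ℕ)
    (F : Finset ℕ) : ∑ i ∈ F, a i ^ N ≤ ∑ k ∈ Finset.range F.card, v k ^ N := by
  obtain ⟨σ, hσ, himg, hanti⟩ := exists_injOn_antitoneOn_comp a _ F rfl
  have hsum : ∑ i ∈ F, a i ^ N = ∑ k ∈ Finset.range F.card, a (σ k) ^ N := by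
    conv_lhs => rw [← himg]
    exact Finset.sum_image (by simpa using hσ)
  have step : ∀ j ≤ N, ∑ k ∈ Finset.range F.card, a (σ k) ^ N ≤
      ∑ k ∈ Finset.range F.card, v k ^ j * a (σ k) ^ (N - j) := by
    intro j
    induction j with
    | zero => simp
    | succ j ih =>
      intro hj
      refine (ih (by omega)).trans ?_
      -- The remaining factors form a nonnegative decreasing weight, since both `v` and `a ∘ σ`
      -- decrease.
      have h1 := sum_mul_le_of_antitoneOn (u := fun k => v k ^ j * a (σ k) ^ (N - (j + 1)))
        (a := fun k => a (σ k)) (b := v) (n := F.card)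
        (by
          intro i hi k hk hik
          exact mul_le_mul (pow_le_pow_left₀ (hv0 _) (hv hik) _)
            (pow_le_pow_left₀ (ha _) (hanti hi hk hik) _) (pow_nonneg (ha _) _)
            (pow_nonneg (hv0 _) _))
        (fun k _ => mul_nonneg (pow_nonneg (hv0 _) _) (pow_nonneg (ha _) _))
        (fun m hm => sum_range_comp_le h hσ hm)
      refine (le_of_eq ?_).trans (h1.trans (le_of_eq ?_))
      · refine Finset.sum_congr rfl fun k _ => ?_
        rw [mul_assoc, ← pow_succ, show N - (j + 1) + 1 = N - j by omega]
      · exact Finset.sum_congr rfl fun k _ => by ring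
  rw [hsum]
  simpa using step N le_rfl

/-! ### Finitely supported elements of `d(w,1)` -/

namespace Lorentz

variable {w : AdmissibleSeq}

/-- At most `min m F.card` of the first `m` values of `σ` lie in `F`, so the indicator of `F` along
`σ` is majorized by that of an initial segment. -/
theorem sum_weight_le_of_support_subset {b : ℕ → ℂ} {F : Finset ℕ}
    (hb : ∀ i, ‖b i‖ ≤ if i ∈ F then 1 else 0) (n : ℕ) (σ : ℕ → ℕ)
    (hσ : Set.InjOn σ (Set.Iio n)) :
    ∑ k ∈ Finset.range n, w k * ‖b (σ k)‖ ≤ ∑ k ∈ Finset.range F.card, w k := by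
  classical
  have h1 : ∑ k ∈ Finset.range n, w k * ‖b (σ k)‖ ≤
      ∑ k ∈ Finset.range n, w k * (if k < F.card then 1 else 0) := by
    refine sum_mul_le_of_antitone w.antitone (fun n => (w.pos n).le) n fun m hm => ?_
    have hinj : Set.InjOn σ (Finset.range m : Set ℕ) := by
      refine hσ.mono fun k hk => ?_
      simp only [Finset.coe_range, Set.mem_Iio] at hk ⊢
      omega
    refine (Finset.sum_le_sum fun k _ => hb (σ k)).trans ?_
    rw [← Finset.sum_filter, ← Finset.sum_filter, Finset.sum_const, Finset.sum_const,
      nsmul_one, nsmul_one]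
    have h2 : (Finset.range m).filter (fun k => k < F.card) = Finset.range (min m F.card) := by
      ext k
      simp
    rw [h2, Finset.card_range]
    have h3 : ((Finset.range m).filter (fun k => σ k ∈ F)).card ≤ F.card := by
      refine Finset.card_le_card_of_injOn σ (fun k hk => ?_) (hinj.mono ?_)
      · simpa using (Finset.mem_filter.1 hk).2
      · exact_mod_cast Finset.filter_subset _ _
    have h4 : ((Finset.range m).filter (fun k => σ k ∈ F)).card ≤ m :=
      (Finset.card_filter_le _ _).trans (by simp)
    exact_mod_cast le_min h4 h3
  refine h1.trans ?_
  simp only [mul_ite, mul_one, mul_zero]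
  rw [← Finset.sum_filter]
  refine Finset.sum_le_sum_of_subset_of_nonneg (fun k hk => ?_) fun k _ _ => (w.pos k).le
  simpa using (Finset.mem_filter.1 hk).2

theorem norm_le_sum_weight {a : Lorentz w} {F : Finset ℕ}
    (ha : ∀ i, ‖a.seq i‖ ≤ if i ∈ F then 1 else 0) :
    ‖a‖ ≤ ∑ k ∈ Finset.range F.card, w k :=
  (memLorentz_of_bound a.memLorentz.1 (sum_weight_le_of_support_subset ha)).2

theorem norm_le_of_seq_le {a b : Lorentz w} (h : ∀ i, ‖a.seq i‖ ≤ ‖b.seq i‖) : ‖a‖ ≤ ‖b‖ := by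
  refine (memLorentz_of_bound a.memLorentz.1 fun n σ hσ => ?_).2
  exact (Finset.sum_le_sum fun k _ => mul_le_mul_of_nonneg_left (h _) (w.pos k).le).trans
    (b.memLorentz.sum_le n σ hσ)

/-- The `k`-th unit vector of `d(w,1)`. -/
def unitVec (w : AdmissibleSeq) (k : ℕ) : Lorentz w :=
  ⟨Pi.single k 1, by
    have h : ∀ i, ‖(Pi.single k 1 : ℕ → ℂ) i‖ ≤ if i ∈ ({k} : Finset ℕ) then 1 else 0 := by
      intro i
      by_cases hi : i = k
      · subst hi
        simp
      · simp [hi]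
    refine (memLorentz_of_bound ⟨1, fun i => (h i).trans ?_⟩
      (sum_weight_le_of_support_subset h)).1
    split_ifs <;> norm_num⟩

theorem seq_unitVec (k i : ℕ) : (unitVec w k).seq i = if i = k then 1 else 0 := by
  change (Pi.single k 1 : ℕ → ℂ) i = _
  rw [Pi.single_apply]

theorem seq_sum_smul_unitVec (F : Finset ℕ) (c : ℕ → ℂ) (i : ℕ) :
    (∑ k ∈ F, c k • unitVec w k).seq i = if i ∈ F then c i else 0 := by
  rw [← coord_apply, map_sum]
  simp only [map_smul, coord_apply, seq_unitVec, smul_eq_mul, mul_ite, mul_one, mul_zero]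
  rw [Finset.sum_ite_eq]

theorem norm_sum_smul_unitVec_le (F : Finset ℕ) (a : Lorentz w) :
    ‖∑ k ∈ F, a.seq k • unitVec w k‖ ≤ ‖a‖ := by
  refine norm_le_of_seq_le fun i => ?_
  rw [seq_sum_smul_unitVec]
  split_ifs
  · exact le_rfl
  · simp

end Lorentz

/-! ### Coefficients and the norm of `d_*(w,1)` -/

namespace LorentzPredual

variable {w : AdmissibleSeq}

/-- The `k`-th coefficient of an element of `d_*(w,1)`. -/
def coeff (w : AdmissibleSeq) (k : ℕ) : StrongDual ℂ (LorentzPredual w) :=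
  (ContinuousLinearMap.apply ℂ ℂ (Lorentz.unitVec w k)).comp (incl w).toContinuousLinearMap

theorem coeff_apply (k : ℕ) (u : LorentzPredual w) :
    coeff w k u = incl w u (Lorentz.unitVec w k) := rfl

theorem coeff_basisVec (k n : ℕ) : coeff w k (basisVec w n) = if n = k then 1 else 0 := by
  rw [coeff_apply, incl_basisVec, Lorentz.coord_apply, Lorentz.seq_unitVec]

theorem norm_basisVec_le (n : ℕ) : ‖basisVec w n‖ ≤ 1 := by
  rw [← (incl w).norm_map, incl_basisVec]
  refine ContinuousLinearMap.opNorm_le_bound _ zero_le_one fun a => ?_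
  rw [one_mul]
  exact Lorentz.norm_seq_le a n

/-- Test `u` against a sequence supported in `F` whose entries, of modulus at most one, align the
phases of the coefficients. -/
theorem sum_norm_coeff_le (u : LorentzPredual w) (F : Finset ℕ) :
    ∑ i ∈ F, ‖coeff w i u‖ ≤ ‖u‖ * ∑ k ∈ Finset.range F.card, w k := by
  have hc : ∀ z : ℂ, ∃ c : ℂ, ‖c‖ ≤ 1 ∧ c * z = ‖z‖ := by
    intro z
    by_cases hz : z = 0
    · exact ⟨0, by simp, by simp [hz]⟩
    · refine ⟨‖z‖ / z, ?_, div_mul_cancel₀ _ hz⟩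
      rw [norm_div, Complex.norm_real, norm_norm, div_self (norm_ne_zero_iff.2 hz)]
  choose c hc1 hc2 using hc
  set a : Lorentz w := ∑ k ∈ F, c (coeff w k u) • Lorentz.unitVec w k with ha
  have h1 : incl w u a = (∑ i ∈ F, ‖coeff w i u‖ : ℝ) := by
    rw [ha, map_sum]
    push_cast
    refine Finset.sum_congr rfl fun k _ => ?_
    rw [map_smul, ← coeff_apply, smul_eq_mul, hc2]
  have h2 := (incl w u).le_opNorm a
  rw [h1, Complex.norm_real, (incl w).norm_map] at h2
  refine (le_abs_self _).trans (h2.trans (mul_le_mul_of_nonneg_left ?_ (norm_nonneg u)))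
  refine Lorentz.norm_le_sum_weight fun i => ?_
  rw [ha, Lorentz.seq_sum_smul_unitVec F (fun k => c (coeff w k u))]
  split_ifs
  · exact hc1 _
  · simp

theorem norm_coeff_le (u : LorentzPredual w) (k : ℕ) : ‖coeff w k u‖ ≤ ‖u‖ := by
  simpa [w.zero_eq_one] using sum_norm_coeff_le u {k}

/-- The partial sums of the expansion along the basis vectors. -/
def partialSum (w : AdmissibleSeq) (n : ℕ) : LorentzPredual w →ₗ[ℂ] LorentzPredual w :=
  ∑ k ∈ Finset.range n, (coeff w k).toLinearMap.smulRight (basisVec w k)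

theorem partialSum_apply (n : ℕ) (u : LorentzPredual w) :
    partialSum w n u = ∑ k ∈ Finset.range n, coeff w k u • basisVec w k := by
  simp [partialSum]

theorem incl_partialSum (n : ℕ) (u : LorentzPredual w) (a : Lorentz w) :
    incl w (partialSum w n u) a = ∑ k ∈ Finset.range n, coeff w k u * a.seq k := by
  rw [partialSum_apply, map_sum, sum_apply]
  rfl

/-- By duality, a partial sum of `u` acts on `a` as `u` acts on a truncation of `a`, and truncation
does not increase the norm of `d(w,1)`. -/
theorem norm_partialSum_le (n : ℕ) (u : LorentzPredual w) : ‖partialSum w n u‖ ≤ ‖u‖ := by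
  rw [← (incl w).norm_map]
  refine ContinuousLinearMap.opNorm_le_bound _ (norm_nonneg u) fun a => ?_
  have h : incl w (partialSum w n u) a =
      incl w u (∑ k ∈ Finset.range n, a.seq k • Lorentz.unitVec w k) := by
    rw [incl_partialSum, map_sum]
    refine Finset.sum_congr rfl fun k _ => ?_
    rw [map_smul, coeff_apply, smul_eq_mul, mul_comm]
  rw [h, ← (incl w).norm_map u]
  exact ((incl w u).le_opNorm _).trans
    (mul_le_mul_of_nonneg_left (Lorentz.norm_sum_smul_unitVec_le _ a) (norm_nonneg _))

theorem eventually_partialSum_eq {v : LorentzPredual w}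
    (hv : v ∈ Submodule.span ℂ (Set.range (basisVec w))) :
    ∀ᶠ n in Filter.atTop, partialSum w n v = v := by
  induction hv using Submodule.span_induction with
  | mem x hx =>
    obtain ⟨k, rfl⟩ := hx
    filter_upwards [Filter.eventually_gt_atTop k] with n hn
    rw [partialSum_apply]
    simp only [coeff_basisVec, ite_smul, one_smul, zero_smul]
    rw [Finset.sum_ite_eq, if_pos (Finset.mem_range.2 hn)]
  | zero => simp
  | add x y _ _ hx hy =>
    filter_upwards [hx, hy] with n h1 h2
    rw [map_add, h1, h2]
  | smul c x _ hx =>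
    filter_upwards [hx] with n h1
    rw [map_smul, h1]

/-- The partial sum operators are contractions and eventually fix each vector of the dense span. -/
theorem tendsto_partialSum (u : LorentzPredual w) :
    Filter.Tendsto (fun n => partialSum w n u) Filter.atTop (nhds u) := by
  rw [Metric.tendsto_nhds]
  intro ε hε
  obtain ⟨v, hv, huv⟩ := Metric.mem_closure_iff.1 (dense_span_basisVec u) (ε / 2) (half_pos hε)
  filter_upwards [eventually_partialSum_eq hv] with n hn
  rw [dist_eq_norm] at huv ⊢
  have h1 : partialSum w n u - u = partialSum w n (u - v) - (u - v) := by
    rw [map_sub, hn]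
    abel
  rw [h1]
  exact (norm_sub_le _ _).trans_lt (by linarith [norm_partialSum_le n (u - v)])

theorem tendsto_coeff (u : LorentzPredual w) :
    Filter.Tendsto (fun n => coeff w n u) Filter.atTop (nhds 0) := by
  have h := tendsto_iff_norm_sub_tendsto_zero.1 (tendsto_partialSum u)
  refine squeeze_zero_norm (fun n => ?_) h
  -- The `n`-th partial sum stops at index `n - 1`, so its `n`-th coefficient is zero.
  have h1 : coeff w n (partialSum w n u - u) = - coeff w n u := by
    rw [map_sub, partialSum_apply, map_sum, Finset.sum_eq_zero, zero_sub]
    intro k hk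
    rw [map_smul, coeff_basisVec, if_neg (Finset.mem_range.1 hk).ne, smul_zero]
  rw [← norm_neg, ← h1]
  exact norm_coeff_le _ _

/-- Converse of `sum_norm_coeff_le`. For a partial sum tested against `a`, sort `|a|` decreasingly;
Abel summation then replaces the coefficients by `C * w k`. -/
theorem norm_le_of_sum_norm_coeff_le {u : LorentzPredual w} {C : ℝ} (hC : 0 ≤ C)
    (h : ∀ F : Finset ℕ, ∑ i ∈ F, ‖coeff w i u‖ ≤ C * ∑ k ∈ Finset.range F.card, w k) :
    ‖u‖ ≤ C := by
  refine le_of_tendsto (tendsto_partialSum u).norm (Filter.Eventually.of_forall fun n => ?_)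
  rw [← (incl w).norm_map]
  refine ContinuousLinearMap.opNorm_le_bound _ hC fun a => ?_
  rw [incl_partialSum]
  obtain ⟨σ, hσ, himg, hanti⟩ :=
    exists_injOn_antitoneOn_comp (fun i => ‖a.seq i‖) n (Finset.range n) (Finset.card_range n)
  have h1 := sum_mul_le_of_antitoneOn (u := fun k => ‖a.seq (σ k)‖)
    (a := fun k => ‖coeff w (σ k) u‖) (b := fun k => C * w k) hanti (fun k _ => norm_nonneg _)
    (fun m hm => sum_range_comp_le (a := fun i => ‖coeff w i u‖)
      (by simpa only [Finset.mul_sum] using h) hσ hm)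
  calc ‖∑ k ∈ Finset.range n, coeff w k u * a.seq k‖
      ≤ ∑ k ∈ Finset.range n, ‖a.seq k‖ * ‖coeff w k u‖ :=
        norm_sum_le_of_le _ fun k _ => by rw [norm_mul, mul_comm]
    _ = ∑ k ∈ Finset.range n, ‖a.seq (σ k)‖ * ‖coeff w (σ k) u‖ := by
        conv_lhs => rw [← himg]
        exact Finset.sum_image (by simpa using hσ)
    _ ≤ ∑ k ∈ Finset.range n, ‖a.seq (σ k)‖ * (C * w k) := h1
    _ = C * ∑ k ∈ Finset.range n, w k * ‖a.seq (σ k)‖ := by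
        rw [Finset.mul_sum]
        exact Finset.sum_congr rfl fun k _ => by ring
    _ ≤ C * ‖a‖ := mul_le_mul_of_nonneg_left (a.memLorentz.sum_le n σ hσ) hC

/-- The sum of `m` coefficients is of smaller order than the sum of the first `m` weights. -/
theorem exists_sum_norm_coeff_le (u : LorentzPredual w) {η : ℝ} (hη : 0 < η) :
    ∃ m₀ : ℕ, ∀ F : Finset ℕ, m₀ ≤ F.card →
      ∑ i ∈ F, ‖coeff w i u‖ ≤ η * ∑ k ∈ Finset.range F.card, w k := by
  -- Split off a partial sum with remainder of norm below `η / 2`. The coefficients of the partial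
  -- sum contribute a bounded amount, absorbed by the other half once the sum of the weights is
  -- large.
  obtain ⟨n, hn⟩ := ((Metric.tendsto_nhds.1 (tendsto_partialSum u)) (η / 2) (half_pos hη)).exists
  have hW : Filter.Tendsto (fun m => ∑ k ∈ Finset.range m, w k) Filter.atTop Filter.atTop :=
    (not_summable_iff_tendsto_nat_atTop_of_nonneg fun k => (w.pos k).le).1 w.not_summable
  obtain ⟨m₀, hm₀⟩ := Filter.eventually_atTop.1
    (hW.eventually_ge_atTop ((∑ k ∈ Finset.range n, ‖coeff w k u‖) / (η / 2)))
  refine ⟨m₀, fun F hF => ?_⟩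
  have h1 := hm₀ _ hF
  rw [div_le_iff₀ (half_pos hη)] at h1
  rw [dist_eq_norm, norm_sub_rev] at hn
  have h2 : ∀ i, ‖coeff w i u‖ ≤ ‖coeff w i (u - partialSum w n u)‖ +
      if i ∈ Finset.range n then ‖coeff w i u‖ else 0 := by
    intro i
    have h3 : coeff w i (partialSum w n u) =
        if i ∈ Finset.range n then coeff w i u else 0 := by
      rw [partialSum_apply, map_sum]
      simp only [map_smul, coeff_basisVec, smul_eq_mul, mul_ite, mul_one, mul_zero]
      rw [Finset.sum_ite_eq']
    rw [map_sub, h3]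
    split_ifs <;> simp
  have h3 : ∑ i ∈ F, (if i ∈ Finset.range n then ‖coeff w i u‖ else 0) ≤
      ∑ k ∈ Finset.range n, ‖coeff w k u‖ := by
    rw [← Finset.sum_filter]
    refine Finset.sum_le_sum_of_subset_of_nonneg (fun k hk => ?_) fun k _ _ => norm_nonneg _
    exact (Finset.mem_filter.1 hk).2
  have h4 := sum_norm_coeff_le (u - partialSum w n u) F
  have h5 : 0 ≤ ∑ k ∈ Finset.range F.card, w k := Finset.sum_nonneg fun k _ => (w.pos k).le
  have h6 := Finset.sum_le_sum fun i (_ : i ∈ F) => h2 i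
  rw [Finset.sum_add_distrib] at h6
  nlinarith [mul_le_mul_of_nonneg_right hn.le h5]

/-- Around every point of `d_*(w,1)`, the sphere through that point is flat in the directions of
all but finitely many basis vectors. -/
theorem exists_norm_add_smul_basisVec_le {u : LorentzPredual w} (hu : u ≠ 0) :
    ∃ δ > 0, ∀ᶠ n in Filter.atTop, ∀ c : ℂ, ‖c‖ ≤ δ → ‖u + c • basisVec w n‖ ≤ ‖u‖ := by
  have hr : 0 < ‖u‖ := norm_pos_iff.2 hu
  obtain ⟨m₀, hm₀⟩ := exists_sum_norm_coeff_le u (half_pos hr)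
  have hδ : 0 < ‖u‖ / 2 * w m₀ := mul_pos (half_pos hr) (w.pos m₀)
  refine ⟨‖u‖ / 2 * w m₀, hδ, ?_⟩
  filter_upwards [(tendsto_coeff u).norm.eventually_le_const (by simpa using hδ)] with n hn c hc
  refine norm_le_of_sum_norm_coeff_le hr.le fun F => ?_
  have hco : ∀ i, coeff w i (u + c • basisVec w n) = coeff w i u + if n = i then c else 0 := by
    intro i
    rw [map_add, map_smul, coeff_basisVec]
    simp
  have hco' : ∀ i, i ≠ n → coeff w i (u + c • basisVec w n) = coeff w i u := by
    intro i hi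
    rw [hco, if_neg hi.symm, add_zero]
  by_cases hnF : n ∈ F
  · have hcard : (F.erase n).card + 1 = F.card := Finset.card_erase_add_one hnF
    have h0 : ‖coeff w n (u + c • basisVec w n)‖ ≤ ‖coeff w n u‖ + ‖c‖ := by
      rw [hco, if_pos rfl]
      exact norm_add_le _ _
    have hsum : ∑ i ∈ F.erase n, ‖coeff w i (u + c • basisVec w n)‖ =
        ∑ i ∈ F.erase n, ‖coeff w i u‖ :=
      Finset.sum_congr rfl fun i hi => by rw [hco' i (Finset.ne_of_mem_erase hi)]
    rw [← Finset.sum_erase_add _ _ hnF, hsum]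
    -- Large sets have slack `‖u‖ / 2` times the sum of the weights, which is at least `δ`. For
    -- small sets the index `n` brings the extra weight `w (F.card - 1) ≥ w m₀`, and its coefficient
    -- is at most `2δ = ‖u‖ * w m₀`.
    by_cases hm : m₀ ≤ F.card
    · have h1 := hm₀ F hm
      rw [← Finset.sum_erase_add _ _ hnF] at h1
      have h2 : w m₀ ≤ ∑ k ∈ Finset.range F.card, w k :=
        (w.antitone (Nat.zero_le m₀)).trans
          (Finset.single_le_sum (f := fun k => w k) (fun k _ => (w.pos k).le)
            (Finset.mem_range.2 (by omega)))
      nlinarith [mul_le_mul_of_nonneg_left h2 (half_pos hr).le]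
    · have h1 := sum_norm_coeff_le u (F.erase n)
      have h2 : w m₀ ≤ w (F.erase n).card := w.antitone (by omega)
      rw [← hcard, Finset.sum_range_succ, mul_add]
      nlinarith [mul_le_mul_of_nonneg_left h2 hr.le]
  · rw [Finset.sum_congr rfl fun i hi => by rw [hco' i (fun h => hnF (h ▸ hi))]]
    exact sum_norm_coeff_le u F

end LorentzPredual

/-! ### The diagonal polynomial -/

/-- A crude arithmetic-geometric mean inequality through the largest factor. -/
theorem Finset.prod_le_sum_pow_card {ι : Type*} [Fintype ι] [Nonempty ι] {b : ι → ℝ}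
    (hb : ∀ i, 0 ≤ b i) : ∏ i, b i ≤ ∑ i, b i ^ Fintype.card ι := by
  obtain ⟨j, -, hj⟩ := Finset.univ.exists_max_image b Finset.univ_nonempty
  calc ∏ i, b i ≤ ∏ _i : ι, b j := Finset.prod_le_prod (fun i _ => hb i) fun i hi => hj i hi
    _ = b j ^ Fintype.card ι := by simp
    _ ≤ ∑ i, b i ^ Fintype.card ι :=
      Finset.single_le_sum (f := fun i => b i ^ Fintype.card ι)
        (fun i _ => pow_nonneg (hb i) _) (Finset.mem_univ j)

namespace LorentzPredual

variable {w : AdmissibleSeq} {N : ℕ}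

/-- The coefficients of a normalized vector are weakly majorized by `w`; for `u = 0` the quotients
are zero by convention. -/
theorem sum_pow_norm_coeff_div_le (hw : Summable fun k => w k ^ N) (u : LorentzPredual w)
    (F : Finset ℕ) : ∑ k ∈ F, (‖coeff w k u‖ / ‖u‖) ^ N ≤ ∑' k, w k ^ N := by
  refine (sum_pow_le_of_sum_le (v := fun k => w k)
    (fun i => div_nonneg (norm_nonneg _) (norm_nonneg _))
    w.antitone (fun k => (w.pos k).le) (fun G => ?_) N F).trans
    (hw.sum_le_tsum _ fun k _ => pow_nonneg (w.pos k).le N)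
  rw [← Finset.sum_div]
  exact div_le_of_le_mul₀ (norm_nonneg _) (Finset.sum_nonneg fun k _ => (w.pos k).le)
    ((sum_norm_coeff_le u G).trans_eq (mul_comm _ _))

/-- Gives both convergence and continuity of the diagonal form: normalize each argument, then bound
products by sums of `N`-th powers. -/
theorem sum_prod_norm_coeff_le (hN : N ≠ 0) (hw : Summable fun k => w k ^ N)
    (u : Fin N → LorentzPredual w) (F : Finset ℕ) :
    ∑ k ∈ F, ‖∏ i, coeff w k (u i)‖ ≤ (N * ∑' k, w k ^ N) * ∏ i, ‖u i‖ := by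
  have : Nonempty (Fin N) := ⟨⟨0, Nat.pos_of_ne_zero hN⟩⟩
  have h1 : ∀ k, ‖∏ i, coeff w k (u i)‖ =
      (∏ i, ‖coeff w k (u i)‖ / ‖u i‖) * ∏ i, ‖u i‖ := by
    intro k
    rw [norm_prod, ← Finset.prod_mul_distrib]
    refine Finset.prod_congr rfl fun i _ => ?_
    by_cases hi : u i = 0
    · simp [hi]
    · rw [div_mul_cancel₀ _ (norm_ne_zero_iff.2 hi)]
  simp only [h1]
  rw [← Finset.sum_mul]
  refine mul_le_mul_of_nonneg_right ?_ (Finset.prod_nonneg fun i _ => norm_nonneg _)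
  calc ∑ k ∈ F, ∏ i, ‖coeff w k (u i)‖ / ‖u i‖
      ≤ ∑ k ∈ F, ∑ i, (‖coeff w k (u i)‖ / ‖u i‖) ^ N := by
        refine Finset.sum_le_sum fun k _ => ?_
        simpa using Finset.prod_le_sum_pow_card (b := fun i => ‖coeff w k (u i)‖ / ‖u i‖)
          fun i => div_nonneg (norm_nonneg _) (norm_nonneg _)
    _ = ∑ i, ∑ k ∈ F, (‖coeff w k (u i)‖ / ‖u i‖) ^ N := Finset.sum_comm
    _ ≤ ∑ _i : Fin N, ∑' k, w k ^ N :=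
        Finset.sum_le_sum fun i _ => sum_pow_norm_coeff_div_le hw (u i) F
    _ = N * ∑' k, w k ^ N := by simp

theorem summable_norm_prod_coeff (hN : N ≠ 0) (hw : Summable fun k => w k ^ N)
    (u : Fin N → LorentzPredual w) : Summable fun k => ‖∏ i, coeff w k (u i)‖ :=
  summable_of_sum_le (fun _ => norm_nonneg _) (sum_prod_norm_coeff_le hN hw u)

/-- The product of the `k`-th coefficients, as a multilinear form. -/
def coeffProd (w : AdmissibleSeq) (N k : ℕ) :
    MultilinearMap ℂ (fun _ : Fin N => LorentzPredual w) ℂ :=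
  (MultilinearMap.mkPiAlgebra ℂ (Fin N) ℂ).compLinearMap fun _ => (coeff w k).toLinearMap

theorem coeffProd_apply (k : ℕ) (u : Fin N → LorentzPredual w) :
    coeffProd w N k u = ∏ i, coeff w k (u i) := by
  simp [coeffProd]

/-- The diagonal form `(u₁, …, u_N) ↦ ∑ₖ u₁(k) ⋯ u_N(k)`. -/
def diagForm (hN : N ≠ 0) (hw : Summable fun k => w k ^ N) :
    ContinuousMultilinearMap ℂ (fun _ : Fin N => LorentzPredual w) ℂ :=
  have hs : ∀ u : Fin N → LorentzPredual w, Summable fun k => coeffProd w N k u := fun u => by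
    simpa only [coeffProd_apply] using (summable_norm_prod_coeff hN hw u).of_norm
  MultilinearMap.mkContinuous
    { toFun := fun u => ∑' k, coeffProd w N k u
      map_update_add' := fun u i x y => by
        simp only [MultilinearMap.map_update_add]
        exact (hs _).tsum_add (hs _)
      map_update_smul' := fun u i c x => by
        simp only [MultilinearMap.map_update_smul]
        exact (hs _).tsum_const_smul c }
    (N * ∑' k, w k ^ N) fun u => by
      change ‖∑' k, coeffProd w N k u‖ ≤ _
      simp only [coeffProd_apply]
      have h := summable_norm_prod_coeff hN hw u
      exact (norm_tsum_le_tsum_norm h).trans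
        (h.tsum_le_of_sum_le (sum_prod_norm_coeff_le hN hw u))

theorem diagForm_apply (hN : N ≠ 0) (hw : Summable fun k => w k ^ N)
    (u : Fin N → LorentzPredual w) : diagForm hN hw u = ∑' k, ∏ i, coeff w k (u i) := by
  change ∑' k, coeffProd w N k u = _
  simp only [coeffProd_apply]

theorem diagForm_const (hN : N ≠ 0) (hw : Summable fun k => w k ^ N) (u : LorentzPredual w) :
    diagForm hN hw (fun _ => u) = ∑' k, coeff w k u ^ N := by
  simp [diagForm_apply]

theorem summable_coeff_pow (hN : N ≠ 0) (hw : Summable fun k => w k ^ N)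
    (u : LorentzPredual w) : Summable fun k => coeff w k u ^ N := by
  simpa using (summable_norm_prod_coeff hN hw fun _ => u).of_norm

/-- The two series differ only in the `n`-th term. -/
theorem diagForm_add_smul_basisVec (hN : N ≠ 0) (hw : Summable fun k => w k ^ N)
    (u : LorentzPredual w) (c : ℂ) (n : ℕ) :
    diagForm hN hw (fun _ => u + c • basisVec w n) - diagForm hN hw (fun _ => u) =
      (coeff w n u + c) ^ N - coeff w n u ^ N := by
  rw [diagForm_const, diagForm_const,
    ← (summable_coeff_pow hN hw _).tsum_sub (summable_coeff_pow hN hw _), tsum_eq_single n]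
  · simp [coeff_basisVec]
  · intro k hk
    simp [coeff_basisVec, hk.symm]

/-- The polynomial `x ↦ (∑ₖ x(k)^N) y`. -/
def diagPoly {Y : Type*} [NormedAddCommGroup Y] [NormedSpace ℂ Y] (hN : N ≠ 0)
    (hw : Summable fun k => w k ^ N) (y : Y) : HomPoly (LorentzPredual w) Y N :=
  ⟨fun x => diagForm hN hw (fun _ => x) • y,
    (ContinuousLinearMap.toSpanSingleton ℂ y).compContinuousMultilinearMap (diagForm hN hw),
    fun σ u => by
      change diagForm hN hw (u ∘ σ) • y = diagForm hN hw u • y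
      rw [diagForm_apply, diagForm_apply]
      congr 2
      funext k
      exact Equiv.prod_comp σ fun i => coeff w k (u i),
    fun x => rfl⟩

theorem toAu_diagPoly_apply {Y : Type*} [NormedAddCommGroup Y] [NormedSpace ℂ Y] (hN : N ≠ 0)
    (hw : Summable fun k => w k ^ N) (y : Y) (x : UnitBall (LorentzPredual w)) :
    (HomPoly.toAu (diagPoly hN hw y)).1 x =
      diagForm hN hw (fun _ => (x : LorentzPredual w)) • y :=
  HomPoly.toAu_apply _ x

end LorentzPredual

/-! ### Functions that attain their `v`-norm -/

section Attaining

variable {X Y : Type*} [NormedAddCommGroup X] [NormedSpace ℂ X]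
  [NormedAddCommGroup Y] [NormedSpace ℂ Y]

/-- If the norm of a holomorphic function attains at `x` its maximum over the ball through `x`, then
the function is constant along the directions in which that ball is flat at `x`. -/
theorem apply_add_smul_eq_of_flat [CompleteSpace Y] [StrictConvexSpace ℝ Y] {F : X → Y}
    (hF : DifferentiableOn ℂ F (Metric.ball 0 1)) {x e : X} (he : ‖e‖ ≤ 1) {δ : ℝ}
    (hδ : 0 < δ) (hflat : ∀ c : ℂ, ‖c‖ ≤ δ → ‖x + c • e‖ ≤ ‖x‖)
    (hmax : ∀ z, ‖z‖ ≤ ‖x‖ → ‖F z‖ ≤ ‖F x‖) {c : ℂ} (hc : ‖c‖ < 1 - ‖x‖) :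
    F (x + c • e) = F x := by
  have hx : 0 < 1 - ‖x‖ := (norm_nonneg c).trans_lt hc
  have hd : DifferentiableOn ℂ (fun z : ℂ => F (x + z • e)) (Metric.ball 0 (1 - ‖x‖)) := by
    refine hF.comp (by fun_prop) fun z hz => ?_
    rw [mem_ball_zero_iff] at hz ⊢
    calc ‖x + z • e‖ ≤ ‖x‖ + ‖z • e‖ := norm_add_le _ _
      _ ≤ ‖x‖ + ‖z‖ := by
        rw [norm_smul]
        gcongr
        exact mul_le_of_le_one_right (norm_nonneg z) he
      _ < 1 := by linarith
  have hnhds : Metric.ball (0 : ℂ) (1 - ‖x‖) ∈ nhds 0 := Metric.ball_mem_nhds _ hx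
  -- Flatness is needed only on the disc of radius `δ`, however small.
  have hloc : IsLocalMax (norm ∘ fun z : ℂ => F (x + z • e)) 0 := by
    filter_upwards [Metric.ball_mem_nhds (0 : ℂ) hδ] with z hz
    simpa using hmax _ (hflat z (mem_ball_zero_iff.1 hz).le)
  -- Strict convexity of `Y` makes the function itself, not just its norm, locally constant.
  have hev := Complex.eventually_eq_of_isLocalMax_norm
    ((Metric.isOpen_ball.eventually_mem (Metric.mem_ball_self hx)).mono fun z hz =>
      hd.differentiableAt (Metric.isOpen_ball.mem_nhds hz)) hloc
  -- The identity theorem reaches the radius `1 - ‖x‖`, which does not depend on `δ`.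
  have := (hd.analyticOnNhd Metric.isOpen_ball).eqOn_of_preconnected_of_eventuallyEq
    (analyticOnNhd_const (v := F (x + (0 : ℂ) • e))) (convex_ball _ _).isPreconnected
    (Metric.mem_ball_self hx) hev (mem_ball_zero_iff.2 hc)
  simpa using this

theorem AttainsVNorm.exists_mem_ball {f : Au X Y} (hf : AttainsVNorm f) (h0 : 0 < vNorm f) :
    ∃ x : UnitBall X, vNorm f = (1 - ‖(x : X)‖ ^ 2) * ‖f.1 x‖ := by
  obtain ⟨x, hx, h⟩ := hf
  rw [mem_closedBall_zero_iff] at hx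
  rcases hx.lt_or_eq with hlt | heq
  · refine ⟨⟨x, mem_ball_zero_iff.2 hlt⟩, ?_⟩
    rw [h]
    congr 2
    exact Subtype.val_injective.extend_apply _ _ (⟨x, mem_ball_zero_iff.2 hlt⟩ : UnitBall X)
  · rw [heq] at h
    norm_num at h
    exact absurd h h0.ne'

theorem le_vNorm (f : Au X Y) (x : UnitBall X) :
    (1 - ‖(x : X)‖ ^ 2) * ‖f.1 x‖ ≤ vNorm f :=
  le_ciSup (bddAbove_vNorm f) x

/-- The weight at `z` is at least the positive weight at `x`. -/
theorem norm_le_of_vNorm_eq {f : Au X Y} {x z : UnitBall X}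
    (hx : vNorm f = (1 - ‖(x : X)‖ ^ 2) * ‖f.1 x‖) (hz : ‖(z : X)‖ ≤ ‖(x : X)‖) :
    ‖f.1 z‖ ≤ ‖f.1 x‖ := by
  have h1 := le_vNorm f z
  have hx1 : ‖(x : X)‖ < 1 := mem_ball_zero_iff.1 x.2
  have h2 : 0 < 1 - ‖(x : X)‖ ^ 2 := by nlinarith [norm_nonneg (x : X)]
  have h3 : 1 - ‖(x : X)‖ ^ 2 ≤ 1 - ‖(z : X)‖ ^ 2 := by nlinarith [norm_nonneg (z : X)]
  rw [hx] at h1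
  exact le_of_mul_le_mul_left ((mul_le_mul_of_nonneg_right h3 (norm_nonneg _)).trans h1) h2

theorem norm_sub_apply_le (f g : Au X Y) (x : UnitBall X) : ‖f.1 x - g.1 x‖ ≤ dist f g := by
  rw [← dist_eq_norm]
  exact BoundedContinuousFunction.dist_coe_le_dist x

end Attaining

/-! ### Separation of the diagonal polynomial from the `v`-norm attaining functions -/

namespace LorentzPredual

variable {w : AdmissibleSeq} {N : ℕ} {Y : Type*} [NormedAddCommGroup Y] [NormedSpace ℂ Y]

/-- A function that attains its `v`-norm at `x` and is close to the diagonal polynomial attains it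
close to the unit sphere. -/
theorem pow_le_of_dist_toAu_diagPoly_le [CompleteSpace Y] [StrictConvexSpace ℝ Y] (hN : N ≠ 0)
    (hw : Summable fun k => w k ^ N) {y : Y} (hy : ‖y‖ = 1)
    {f : Au (LorentzPredual w) Y} {ε : ℝ} (hf : dist (HomPoly.toAu (diagPoly hN hw y)) f ≤ ε)
    {x : UnitBall (LorentzPredual w)} (hx0 : (x : LorentzPredual w) ≠ 0)
    (hx : vNorm f = (1 - ‖(x : LorentzPredual w)‖ ^ 2) * ‖f.1 x‖) {ρ : ℝ} (hρ0 : 0 ≤ ρ)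
    (hρ : ρ < 1 - ‖(x : LorentzPredual w)‖) : ρ ^ N ≤ 2 * ε := by
  obtain ⟨-, F, hF, hfF⟩ := f.2
  obtain ⟨δ, hδ, hflat⟩ := exists_norm_add_smul_basisVec_le hx0
  have hx1 : ‖(x : LorentzPredual w)‖ < 1 := mem_ball_zero_iff.1 x.2
  have hρn : ‖(ρ : ℂ)‖ = ρ := by rw [Complex.norm_real, Real.norm_of_nonneg hρ0]
  have hmax : ∀ z, ‖z‖ ≤ ‖(x : LorentzPredual w)‖ → ‖F z‖ ≤ ‖F x‖ := by
    intro z hz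
    have hz' : z ∈ Metric.ball (0 : LorentzPredual w) 1 :=
      mem_ball_zero_iff.2 (hz.trans_lt hx1)
    have := norm_le_of_vNorm_eq (z := ⟨z, hz'⟩) hx hz
    rwa [hfF, hfF] at this
  -- `f` takes the same value at `x` and `x + ρ e_n` and is within `ε` of the polynomial at both
  -- points.
  have key : ∀ᶠ n in Filter.atTop,
      ‖(coeff w n (x : LorentzPredual w) + ρ) ^ N - coeff w n (x : LorentzPredual w) ^ N‖ ≤
        2 * ε := by
    filter_upwards [hflat] with n hn
    have h1 : F (x + (ρ : ℂ) • basisVec w n) = F x :=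
      apply_add_smul_eq_of_flat hF (norm_basisVec_le n) hδ hn hmax (by rwa [hρn])
    have hz : x + (ρ : ℂ) • basisVec w n ∈ Metric.ball (0 : LorentzPredual w) 1 := by
      rw [mem_ball_zero_iff]
      refine (norm_add_le _ _).trans_lt ?_
      rw [norm_smul, hρn]
      nlinarith [norm_basisVec_le (w := w) n]
    have h2 := (norm_sub_apply_le (HomPoly.toAu (diagPoly hN hw y)) f ⟨_, hz⟩).trans hf
    have h3 := (norm_sub_apply_le (HomPoly.toAu (diagPoly hN hw y)) f x).trans hf
    rw [toAu_diagPoly_apply, hfF] at h2 h3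
    simp only [h1] at h2
    calc ‖(coeff w n (x : LorentzPredual w) + ρ) ^ N - coeff w n (x : LorentzPredual w) ^ N‖
        = ‖((coeff w n (x : LorentzPredual w) + ρ) ^ N -
            coeff w n (x : LorentzPredual w) ^ N) • y‖ := by rw [norm_smul, hy, mul_one]
      _ ≤ ε + ε := by
        rw [← diagForm_add_smul_basisVec hN hw, sub_smul,
          ← sub_sub_sub_cancel_right _ _ (F x)]
        exact norm_sub_le_of_le h2 h3
      _ = 2 * ε := (two_mul ε).symm
  -- The coefficients of `x` tend to zero, so only `ρ ^ N` survives in the limit.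
  have hlim : Filter.Tendsto (fun n =>
      ‖(coeff w n (x : LorentzPredual w) + ρ) ^ N - coeff w n (x : LorentzPredual w) ^ N‖)
      Filter.atTop (nhds ‖((0 : ℂ) + ρ) ^ N - 0 ^ N‖) :=
    ((((tendsto_coeff _).add_const _).pow N).sub ((tendsto_coeff _).pow N)).norm
  have := le_of_tendsto hlim key
  rwa [zero_add, zero_pow hN, sub_zero, norm_pow, hρn] at this

theorem toAu_diagPoly_notMem_closure [CompleteSpace Y] [StrictConvexSpace ℝ Y] (hN : N ≠ 0)
    (hw : Summable fun k => w k ^ N) {y : Y} (hy : ‖y‖ = 1) :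
    HomPoly.toAu (diagPoly hN hw y) ∉ closure (NAv (LorentzPredual w) Y) := by
  intro hcl
  set Q := HomPoly.toAu (diagPoly hN hw y) with hQ
  set M : ℝ := ‖Q‖ + 1 with hM
  have hM0 : 0 < M := by positivity
  -- `b` is the norm of the polynomial at `e_0 / 2`, and `M` will bound `‖f x‖`. The choice of `ρ`
  -- forces `ρ < 1 - ‖x‖` once the `v`-norm is at least `b / 2`; the choice of `ε` then contradicts
  -- `ρ ^ N ≤ 2 * ε`.
  set b : ℝ := (1 / 2) ^ N with hb
  have hb0 : 0 < b := by positivity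
  have hb1 : b ≤ 1 := pow_le_one₀ (by norm_num) (by norm_num)
  set ρ : ℝ := b / (8 * M) with hρ
  have hρ0 : 0 < ρ := by positivity
  have hρM : ρ * M = b / 8 := by
    rw [hρ]
    field_simp
  set ε : ℝ := min (b / 8) (ρ ^ N / 4) with hε
  have hε0 : 0 < ε := by positivity
  obtain ⟨f, hf, hdist⟩ := Metric.mem_closure_iff.1 hcl ε hε0
  have hεb : ε ≤ b / 8 := min_le_left _ _
  have hερ : ε ≤ ρ ^ N / 4 := min_le_right _ _
  have hclose : ∀ x, ‖Q.1 x - f.1 x‖ ≤ ε := fun x => (norm_sub_apply_le Q f x).trans hdist.le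
  have hv : b / 2 ≤ vNorm f := by
    have hnorm : ‖(1 / 2 : ℂ) • basisVec w 0‖ ≤ 1 / 2 := by
      rw [norm_smul]
      norm_num
      linarith [norm_basisVec_le (w := w) 0]
    have hmem : (1 / 2 : ℂ) • basisVec w 0 ∈ Metric.ball (0 : LorentzPredual w) 1 :=
      mem_ball_zero_iff.2 (hnorm.trans_lt (by norm_num))
    have h1 := hclose ⟨_, hmem⟩
    have h2 : ‖Q.1 ⟨_, hmem⟩‖ = b := by
      rw [hQ, toAu_diagPoly_apply, norm_smul, hy, mul_one, diagForm_const, tsum_eq_single 0]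
      · simp [coeff_basisVec, hb]
      · intro k hk
        simp [coeff_basisVec, hk.symm, hN]
    have h3 : b - ε ≤ ‖f.1 ⟨_, hmem⟩‖ := by
      have := norm_sub_norm_le (Q.1 ⟨_, hmem⟩) (f.1 ⟨_, hmem⟩)
      linarith
    refine le_trans ?_ (le_vNorm f ⟨_, hmem⟩)
    -- With `ε ≤ b / 8` this gives `(3 / 4) * (7 / 8) * b ≥ b / 2`.
    have h4 : 3 / 4 ≤ 1 - ‖(1 / 2 : ℂ) • basisVec w 0‖ ^ 2 := by
      nlinarith [norm_nonneg ((1 / 2 : ℂ) • basisVec w 0)]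
    refine le_trans ?_ (mul_le_mul h4 h3 (by linarith) (by linarith))
    linarith
  obtain ⟨x, hx⟩ := AttainsVNorm.exists_mem_ball hf (by linarith)
  have hx1 : ‖(x : LorentzPredual w)‖ < 1 := mem_ball_zero_iff.1 x.2
  -- At the origin the polynomial vanishes, so the `v`-norm would be at most `ε ≤ b / 8`.
  have hx0 : (x : LorentzPredual w) ≠ 0 := by
    intro h0
    have h1 := hclose x
    have h2 : Q.1 x = 0 := by
      rw [hQ, toAu_diagPoly_apply, h0, diagForm_const]
      simp [hN]
    rw [h2, zero_sub, norm_neg] at h1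
    rw [h0, norm_zero] at hx
    linarith
  have hfM : ‖f.1 x‖ ≤ M := by
    have h1 : ‖Q.1 x‖ ≤ ‖Q‖ := Q.1.norm_coe_le_norm x
    have h2 := norm_sub_norm_le (f.1 x) (Q.1 x)
    rw [norm_sub_rev] at h2
    linarith [hclose x]
  -- The weight is at most `2 * (1 - ‖x‖)`, hence `b / 2 ≤ 2 * (1 - ‖x‖) * M`, while `ρ * M = b /
  -- 8`.
  have hρx : ρ < 1 - ‖(x : LorentzPredual w)‖ := by
    have h1 : (1 - ‖(x : LorentzPredual w)‖ ^ 2) * ‖f.1 x‖ ≤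
        2 * (1 - ‖(x : LorentzPredual w)‖) * M := by
      refine mul_le_mul ?_ hfM (norm_nonneg _) (by linarith)
      nlinarith [sq_nonneg (1 - ‖(x : LorentzPredual w)‖)]
    refine lt_of_mul_lt_mul_right ?_ hM0.le
    rw [hρM]
    linarith
  have := pow_le_of_dist_toAu_diagPoly_le hN hw hy hdist.le hx0 hx hρ0.le hρx
  have hρN : 0 < ρ ^ N := pow_pos hρ0 N
  linarith

end LorentzPredual

end

theorem theorem3p2 (N : ℕ) (hN : 2 ≤ N) (w : AdmissibleSeq)
    (hw : Memℓp (fun n => w n) (N : ENNReal))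
    (Y : Type*) [NormedAddCommGroup Y] [NormedSpace ℂ Y] [CompleteSpace Y]
    [StrictConvexSpace ℝ Y] [Nontrivial Y] :
    (∃ Q : HomPoly (LorentzPredual w) Y N,
      HomPoly.toAu Q ∉ closure (NAv (LorentzPredual w) Y)) ∧
    ¬ Dense (NAv (LorentzPredual w) Y) := by
  have hN0 : N ≠ 0 := by omega
  have hs : Summable fun k => w k ^ N := by
    have h := (memℓp_gen_iff (by simpa using Nat.pos_of_ne_zero hN0)).1 hw
    refine h.congr fun k => ?_
    rw [ENNReal.toReal_natCast, Real.rpow_natCast, Real.norm_of_nonneg (w.pos k).le]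
  obtain ⟨y, hy⟩ := exists_norm_eq Y zero_le_one
  have hQ := LorentzPredual.toAu_diagPoly_notMem_closure hN0 hs hy
  exact ⟨⟨_, hQ⟩, fun hd => hQ (hd _)⟩
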